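/- Let $X=(\{0,1,S\}\times\{a,b\})^{\mathbb N}\cong\{0,1,S\}^{\mathbb N}\times\{a,b\}^{\mathbb N}$ with the metric $d(x,y)=2^{-\min\{n:\,x_n\neq y_n\}}$ (and $d(x,x)=0$), and let $\lambda$ be the uniform Bernoulli measure on $X$. Take as ideal points the configurations $w0^\infty$, with $w$ a finite word and $0$ a fixed letter, and let $(B_i)_{i\in\mathbb N}$ be a standard computable enumeration of the ideal balls, that is, of the open balls $B(s,r)$ with $s$ an ideal point and $r>0$ rational; $\overline{B}_i$ denotes the corresponding closed ball $\{z: d(z,s)\le r\}$. A map $T:X\to X$ is computable if there are sets $I_m\subset\mathbb N$, recursively enumerable uniformly in $m$, with $T^{-1}(B_m)=\bigcup_{n\in I_m}B_n$ for all $m$. Write $\omega(x)$ for the set of accumulation points of $(T^n(x))_{n\ge 0}$ and $\rho(A)=\{x:\omega(x)\subset A\}$. A closed set $A\subset X$ is a metric attractor of $T$ if $\rho(A)$ has full $\lambda$-measure and there is no closed $A'\subsetneq A$ for which $\rho(A')$ has positive $\lambda$-measure. It is a topological attractor of $T$ if $\rho(A)$ is generic (contains a countable intersection of dense open sets) and there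 is no closed $A'\subsetneq A$ for which $\rho(A')$ is not meager. A closed set $K\subset X$ is computable if $X\setminus K$ is the union of a recursively enumerable family of ideal balls and $\{i: B_i\cap K\ne\emptyset\}$ is recursively enumerable. It is $\Pi_2$ if its outer collection $\{i:\overline{B}_i\cap K=\emptyset\}$ is a $\Sigma_2$ set of natural numbers. It is $\Pi_2$-complete if it is $\Pi_2$ and, for every $\Pi_2$ closed set $K'\subset X$, the outer collection of $K'$ is enumeration reducible to that of $K$ (from an enumeration of the latter one can effectively enumerate the former). **Theorem.** There exist computable maps $T':X\to X$ and $T'':X\to X$ such that: - $T'$ has a computable metric attractor and a $\Pi_2$-complete topological attractor; - $T''$ has a $\Pi_2$-complete metric attractor and a computable topological attractor. In particular, for each of the two maps the metric attractor differs from the topological one (the attractors are wild). -/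

import Mathlib

open MeasureTheory Filter Topology

/-! ### Computable metric spaces -/

/-- A computable metric space: a metric space together with a dense sequence of ideal points whose
mutual distances are uniformly computable. Distances being nonnegative, the rational
approximations are given as fractions `num / (den + 1)` of natural numbers. -/
class ComputableMetricSpace (X : Type*) [MetricSpace X] where
  /-- the sequence of ideal points -/
  idealPoint : ℕ → X
  denseRange_idealPoint : DenseRange idealPoint
  computable_dist : ∃ num den : ℕ × ℕ × ℕ → ℕ, Computable num ∧ Computable den ∧
    ∀ i j n : ℕ, |dist (idealPoint i) (idealPoint j) -
      (num (i, j, n) : ℝ) / ((den (i, j, n) : ℝ) + 1)| ≤ (1 / 2 : ℝ) ^ n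

section Computability

variable {X : Type*} [MetricSpace X] [ComputableMetricSpace X]

/-- The center of the `i`-th ideal ball; `i` codes the triple `(k, p, q)` made of the index `k` of
the center and of the radius `(p + 1) / (q + 1)`. -/
def idealCenter (X : Type*) [MetricSpace X] [ComputableMetricSpace X] (i : ℕ) : X :=
  ComputableMetricSpace.idealPoint i.unpair.1

/-- The radius of the `i`-th ideal ball. Every positive rational occurs. -/
noncomputable def idealRadius (i : ℕ) : ℝ :=
  ((i.unpair.2.unpair.1 : ℝ) + 1) / ((i.unpair.2.unpair.2 : ℝ) + 1)

/-- The `i`-th (open) ideal ball. -/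
def idealBall (X : Type*) [MetricSpace X] [ComputableMetricSpace X] (i : ℕ) : Set X :=
  Metric.ball (idealCenter X i) (idealRadius i)

/-- The closed ball with the center and the radius of the `i`-th ideal ball. -/
def closedIdealBall (X : Type*) [MetricSpace X] [ComputableMetricSpace X] (i : ℕ) : Set X :=
  Metric.closedBall (idealCenter X i) (idealRadius i)

/-- A lower computable (r.e.) open set: the union of an r.e. family of ideal balls. -/
def IsLowerComputableOpen (V : Set X) : Prop :=
  ∃ I : Set ℕ, REPred (fun n : ℕ => n ∈ I) ∧ V = ⋃ n ∈ I, idealBall X n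

/-- A computable map: preimages of ideal balls are lower computable open sets, uniformly. -/
def IsComputableMap (T : X → X) : Prop :=
  ∃ I : ℕ → Set ℕ, REPred (fun p : ℕ × ℕ => p.2 ∈ I p.1) ∧
    ∀ m : ℕ, T ⁻¹' idealBall X m = ⋃ n ∈ I m, idealBall X n

/-- The inner collection: indices of the ideal balls that meet `K`. -/
def innerBalls (K : Set X) : Set ℕ :=
  {i | (idealBall X i ∩ K).Nonempty}

/-- The outer collection: indices of the closed ideal balls that do not meet `K`. -/
def outerBalls (K : Set X) : Set ℕ :=
  {i | closedIdealBall X i ∩ K = ∅}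

/-- A computable closed set: it is upper computable (the complement is a lower computable open set)
and lower computable (meeting an ideal ball is semi-decidable). -/
def IsComputableClosed (K : Set X) : Prop :=
  IsClosed K ∧ IsLowerComputableOpen Kᶜ ∧ REPred (fun i : ℕ => i ∈ innerBalls K)

/-- `Σ₂` sets of natural numbers. -/
def IsSigmaTwo (S : Set ℕ) : Prop :=
  ∃ f : ℕ × ℕ × ℕ → Bool, Computable f ∧ ∀ i : ℕ, i ∈ S ↔ ∃ a : ℕ, ∀ b : ℕ, f (i, a, b) = true

/-- Enumeration reducibility: enumerations of `B` can be effectively turned into enumerations of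
`A`, by means of an r.e. set `W` of rules "once all members of the finite list `D` have been
enumerated, enumerate `n`". -/
def EnumReducible (A B : Set ℕ) : Prop :=
  ∃ W : Set (ℕ × List ℕ), REPred (fun p : ℕ × List ℕ => p ∈ W) ∧
    ∀ n : ℕ, n ∈ A ↔ ∃ D : List ℕ, (n, D) ∈ W ∧ ∀ m ∈ D, m ∈ B

/-- A compact set is `Π₂` if its outer collection is `Σ₂`. -/
def IsPiTwo (K : Set X) : Prop :=
  IsCompact K ∧ IsSigmaTwo (outerBalls K)

/-- A `Π₂`-complete compact set: it is `Π₂`, and from an enumeration of its outer collection one can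
enumerate the outer collection of any other `Π₂` set. -/
def IsPiTwoComplete (K : Set X) : Prop :=
  IsPiTwo K ∧ ∀ K' : Set X, IsPiTwo K' → EnumReducible (outerBalls K') (outerBalls K)

end Computability

/-! ### Attractors -/

section Attractors

variable {X : Type*} [TopologicalSpace X]

/-- The set of accumulation points of the orbit `x, T x, T (T x), …`. -/
def omegaSet (T : X → X) (x : X) : Set X :=
  {y | MapClusterPt y atTop (fun n : ℕ => T^[n] x)}

/-- The realm of topological attraction. -/
def realm (T : X → X) (A : Set X) : Set X :=
  {x | omegaSet T x ⊆ A}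

/-- A metric attractor of `T` for the reference measure `μ`. -/
def IsMetricAttractor [MeasurableSpace X] (μ : Measure X) (T : X → X) (A : Set X) : Prop :=
  IsClosed A ∧ (∀ᵐ x ∂μ, x ∈ realm T A) ∧
    ∀ A' : Set X, IsClosed A' → A' ⊂ A → ¬ 0 < μ (realm T A')

/-- A topological attractor of `T`; `residual X` is the filter of generic sets. -/
def IsTopologicalAttractor (T : X → X) (A : Set X) : Prop :=
  IsClosed A ∧ realm T A ∈ residual X ∧
    ∀ A' : Set X, IsClosed A' → A' ⊂ A → IsMeagre (realm T A')

end Attractors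

/-! ### Symbolic spaces -/

/-- The symbolic space `𝒜^ℕ` over the alphabet `𝒜`. -/
def Config (𝒜 : Type*) : Type _ := ℕ → 𝒜

namespace Config

section Basic

variable {𝒜 : Type*}

/-- The distance `d(x, y) = 2 ^ (- min {n | x n ≠ y n})`, which induces the product topology of the
discrete topologies. -/
noncomputable instance : MetricSpace (Config 𝒜) :=
  letI : TopologicalSpace 𝒜 := ⊥
  haveI : DiscreteTopology 𝒜 := ⟨rfl⟩
  PiNat.metricSpace (E := fun _ : ℕ => 𝒜)

theorem dist_eq_of_ne {x y : Config 𝒜} (h : x ≠ y) :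
    dist x y = (1 / 2 : ℝ) ^ PiNat.firstDiff (E := fun _ : ℕ => 𝒜) x y :=
  PiNat.dist_eq_of_ne (E := fun _ : ℕ => 𝒜) h

instance [MeasurableSpace 𝒜] : MeasurableSpace (Config 𝒜) :=
  inferInstanceAs (MeasurableSpace (ℕ → 𝒜))

/-- The uniform Bernoulli measure: coordinates are independent and uniform in `𝒜`. -/
noncomputable def uniformBernoulli (𝒜 : Type*) [Fintype 𝒜] [Nonempty 𝒜] [MeasurableSpace 𝒜] :
    Measure (Config 𝒜) :=
  Measure.infinitePi (fun _ : ℕ => (PMF.uniformOfFintype 𝒜).toMeasure)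

end Basic

section Computable

variable {𝒜 : Type*}

/-- The configuration `w 0^∞`, where `0` is the distinguished letter `default`. -/
def ofWord [Inhabited 𝒜] (w : List 𝒜) : Config 𝒜 := fun n => w.getD n default

/-- The word with code `i` (the empty word if there is none). -/
def word (𝒜 : Type*) [Primcodable 𝒜] (i : ℕ) : List 𝒜 :=
  ((Encodable.decode i : Option (List 𝒜))).getD []

theorem primrec_word [Primcodable 𝒜] : Primrec (word 𝒜) :=
  Primrec.option_getD.comp Primrec.decode (Primrec.const [])

theorem denseRange_ofWord [Primcodable 𝒜] [Inhabited 𝒜] : DenseRange fun i : ℕ => (ofWord (word 𝒜 i) : Config 𝒜) := by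
  have aux : ∀ (f : ℕ → 𝒜) (n m : ℕ), m < n → f m = ((List.range n).map f).getD m default := by
    intro f n m hm
    simp [hm]
  intro x
  rw [Metric.mem_closure_iff]
  intro ε hε
  obtain ⟨n, hn⟩ := exists_pow_lt_of_lt_one hε (by norm_num : (1 / 2 : ℝ) < 1)
  refine ⟨_, ⟨Encodable.encode ((List.range n).map x), rfl⟩, ?_⟩
  have hw : word 𝒜 (Encodable.encode ((List.range n).map x)) = (List.range n).map x := by
    simp [word]
  simp only [hw]
  by_cases h : x = ofWord ((List.range n).map x)
  · rw [← h]; simpa using hε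
  rw [dist_eq_of_ne h]
  refine lt_of_le_of_lt (pow_le_pow_of_le_one (by norm_num) (by norm_num) ?_) hn
  by_contra hlt
  push Not at hlt
  refine PiNat.apply_firstDiff_ne (E := fun _ : ℕ => 𝒜) h ?_
  exact aux x n _ hlt

variable [Inhabited 𝒜] [DecidableEq 𝒜]

/-- The first index below `|v| + |w|` at which `v 0^∞` and `w 0^∞` differ, or `|v| + |w|`. -/
def wordDiff (v w : List 𝒜) : ℕ :=
  (List.range (v.length + w.length)).findIdx
    (fun n => !(v.getD n default == w.getD n default))

theorem dist_ofWord (v w : List 𝒜) : dist (ofWord v : Config 𝒜) (ofWord w) =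
    if wordDiff v w < v.length + w.length then (1 / 2 : ℝ) ^ wordDiff v w else 0 := by
  have key : ∀ n, (ofWord v : Config 𝒜) n ≠ ofWord w n → n < v.length + w.length := by
    intro n hn
    by_contra hc
    push Not at hc
    apply hn
    have h1 : v.length ≤ n := by omega
    have h2 : w.length ≤ n := by omega
    simp [ofWord, h1, h2]
  split_ifs with h
  · have h' : wordDiff v w < (List.range (v.length + w.length)).length := by simpa using h
    have hs := List.findIdx_getElem (w := h')
    have hmin : ∀ m < wordDiff v w, v.getD m default = w.getD m default := by
      intro m hm
      have := List.not_of_lt_findIdx hm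
      simpa using this
    have hs' : (ofWord v : Config 𝒜) (wordDiff v w) ≠ ofWord w (wordDiff v w) := by
      have : (List.range (v.length + w.length))[wordDiff v w] = wordDiff v w := by simp
      unfold wordDiff at this
      rw [this] at hs
      simpa [ofWord, wordDiff] using hs
    have hne : (ofWord v : Config 𝒜) ≠ ofWord w := fun he => hs' (by rw [he])
    rw [dist_eq_of_ne hne]
    congr 1
    apply le_antisymm
    · by_contra hc
      push Not at hc
      exact hs' (PiNat.apply_eq_of_lt_firstDiff (E := fun _ : ℕ => 𝒜) hc)
    · by_contra hc
      push Not at hc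
      exact PiNat.apply_firstDiff_ne (E := fun _ : ℕ => 𝒜) hne (hmin _ hc)
  · have he : (ofWord v : Config 𝒜) = ofWord w := by
      funext n
      by_contra hn
      have hlt := key n hn
      apply h
      have : wordDiff v w < (List.range (v.length + w.length)).length := by
        apply List.findIdx_lt_length_of_exists
        exact ⟨n, by simpa using hlt, by simpa [ofWord] using hn⟩
      simpa using this
    rw [he, dist_self]

theorem primrec_wordDiff [Primcodable 𝒜] :
    Primrec fun p : ℕ × ℕ × ℕ => wordDiff (word 𝒜 p.1) (word 𝒜 p.2.1) := by
  have hv : Primrec fun p : ℕ × ℕ × ℕ => word 𝒜 p.1 := primrec_word.comp .fst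
  have hw : Primrec fun p : ℕ × ℕ × ℕ => word 𝒜 p.2.1 := primrec_word.comp (.comp .fst .snd)
  refine Primrec.list_findIdx (Primrec.list_range.comp
    (Primrec.nat_add.comp (Primrec.list_length.comp hv) (Primrec.list_length.comp hw))) ?_
  refine Primrec.not.comp (Primrec.beq.comp ?_ ?_)
  · exact (Primrec.list_getD default).comp (hv.comp .fst) .snd
  · exact (Primrec.list_getD default).comp (hw.comp .fst) .snd

theorem primrec_two_pow : Primrec fun n : ℕ => 2 ^ n :=
  (Primrec.nat_rec' (f := fun n : ℕ => n) (g := fun _ => 1) (h := fun _ p => p.2 * 2) .id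
    (.const 1) (Primrec.nat_mul.comp (Primrec.snd.comp .snd) (.const 2))).of_eq fun n => by
    induction n with
    | zero => rfl
    | succ n ih => simp only [pow_succ, ← ih]

/-- The symbolic space is a computable metric space, with the ideal points `w 0^∞`. -/
instance [Primcodable 𝒜] : ComputableMetricSpace (Config 𝒜) where
  idealPoint i := ofWord (word 𝒜 i)
  denseRange_idealPoint := denseRange_ofWord
  computable_dist := by
    have hv : Primrec fun p : ℕ × ℕ × ℕ => word 𝒜 p.1 := primrec_word.comp .fst
    have hw : Primrec fun p : ℕ × ℕ × ℕ => word 𝒜 p.2.1 := primrec_word.comp (.comp .fst .snd)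
    refine ⟨fun p => if wordDiff (word 𝒜 p.1) (word 𝒜 p.2.1) <
        (word 𝒜 p.1).length + (word 𝒜 p.2.1).length then 1 else 0,
      fun p => 2 ^ wordDiff (word 𝒜 p.1) (word 𝒜 p.2.1) - 1, ?_, ?_, ?_⟩
    · refine (Primrec.ite (Primrec.nat_lt.comp primrec_wordDiff (Primrec.nat_add.comp
        (Primrec.list_length.comp hv) (Primrec.list_length.comp hw))) (.const 1)
        (.const 0)).to_comp
    · exact (Primrec.nat_sub.comp (primrec_two_pow.comp primrec_wordDiff) (.const 1)).to_comp
    · intro i j n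
      rw [dist_ofWord]
      have h1 : 1 ≤ 2 ^ wordDiff (word 𝒜 i) (word 𝒜 j) := Nat.one_le_two_pow
      dsimp only
      rw [Nat.cast_sub h1]
      split_ifs
      · simp
      · simp

end Computable

end Config

/-- The alphabet `{0, 1, S} × {a, b}`; configurations over it have two layers, and `Config Letter` is
`{0, 1, S}^ℕ × {a, b}^ℕ`. -/
abbrev Letter : Type := Fin 3 × Fin 2

-- The limit sets are those of streams: `streamLimits y` collects the limits of the shifts of a
-- fixed sequence `y`. The second layer of a configuration `x` marks, by its first `1`, the end of a
-- head. `mixMap D R` shifts the head and appends two letters of the stream `mixture D R x`, so the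
-- head grows by one letter per step and at time `n` displays a window of the mixture starting at a
-- position `n + L`. The limit set of `x` is therefore `streamLimits (mixture D R x)` as soon as a
-- marker exists, which is both almost sure and generic (`iterate_mixMap`, `omegaSet_mixMap`).
--
-- Measure and category are separated by the rare events that select `R` instead of `D` on a dyadic
-- block. Their probabilities are summable, so by Borel-Cantelli almost every mixture is eventually
-- `D` and the metric attractor is `streamLimits D` (`ae_omegaSet_mixMap`). Generically they occur
-- infinitely often within any prescribed infinite set of blocks, so every word found in infinitely
-- many blocks of `R` survives in the limit (`residual_omegaSet_mixMap`).
--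
-- Complexity is carried by `stageStream`, in which the word `1 0^(e+1) S` recurs infinitely often
-- exactly when the code `e` is total. Totality is complete at level `Π₂`, and hence so is
-- `streamLimits stageStream`. The pair (zero stream, `stageStream`) gives `T'`. The pair
-- (`stageStream`, `wordStream`), where `wordStream` contains every first-layer word infinitely
-- often, gives `T''`: its generic limit set is the full shift over the letters with second layer
-- `0`.

namespace Config

-- Cylinder topology and limit sets of streams

section Topology

variable {𝒜 : Type*}

theorem apply_eq_of_dist_lt {x y : Config 𝒜} {n i : ℕ} (h : dist x y < (1 / 2 : ℝ) ^ n)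
    (hi : i ≤ n) : x i = y i :=
  PiNat.apply_eq_of_dist_lt (E := fun _ : ℕ => 𝒜) h hi

theorem dist_le_of_forall_lt {x y : Config 𝒜} {n : ℕ} (h : ∀ i < n, x i = y i) :
    dist x y ≤ (1 / 2 : ℝ) ^ n :=
  (PiNat.mem_cylinder_iff_dist_le (E := fun _ : ℕ => 𝒜)).1 h

theorem dist_lt_iff {x y : Config 𝒜} {r : ℝ} (hr : 0 < r) :
    dist x y < r ↔ ∃ l : ℕ, (1 / 2 : ℝ) ^ l < r ∧ ∀ i < l, x i = y i := by
  refine ⟨fun h => ?_, fun ⟨l, hl, h⟩ => (dist_le_of_forall_lt h).trans_lt hl⟩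
  by_cases hxy : x = y
  · obtain ⟨l, hl⟩ := exists_pow_lt_of_lt_one hr (by norm_num : (1 / 2 : ℝ) < 1)
    exact ⟨l, hl, fun i _ => by rw [hxy]⟩
  · rw [dist_eq_of_ne hxy] at h
    exact ⟨_, h, fun i hi => PiNat.apply_eq_of_lt_firstDiff (E := fun _ : ℕ => 𝒜) hi⟩

theorem dist_le_iff {x y : Config 𝒜} {r : ℝ} (hr : 0 ≤ r) :
    dist x y ≤ r ↔ ∀ l : ℕ, r < (1 / 2 : ℝ) ^ l → x l = y l := by
  refine ⟨fun h l hl => apply_eq_of_dist_lt (h.trans_lt hl) le_rfl, fun h => ?_⟩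
  by_cases hxy : x = y
  · simpa [hxy] using hr
  · rw [dist_eq_of_ne hxy]
    by_contra hc
    exact PiNat.apply_firstDiff_ne (E := fun _ : ℕ => 𝒜) hxy (h _ (not_le.1 hc))

theorem nhds_hasBasis (x : Config 𝒜) :
    (𝓝 x).HasBasis (fun _ : ℕ => True) fun l => {y | ∀ i < l, y i = x i} := by
  refine ⟨fun s => ?_⟩
  rw [Metric.mem_nhds_iff]
  constructor
  · rintro ⟨ε, hε, h⟩
    obtain ⟨l, hl⟩ := exists_pow_lt_of_lt_one hε (by norm_num : (1 / 2 : ℝ) < 1)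
    exact ⟨l, trivial, fun y hy => h ((dist_le_of_forall_lt hy).trans_lt hl)⟩
  · rintro ⟨l, -, h⟩
    exact ⟨(1 / 2) ^ l, by positivity, fun y hy => h fun i hi => apply_eq_of_dist_lt hy hi.le⟩

/-- A set that is decided by the first `N` coordinates is clopen. -/
theorem isClopen_of_forall_lt {s : Set (Config 𝒜)} (N : ℕ)
    (h : ∀ x y : Config 𝒜, (∀ i < N, y i = x i) → x ∈ s → y ∈ s) : IsClopen s := by
  have key : ∀ t : Set (Config 𝒜), (∀ x y : Config 𝒜, (∀ i < N, y i = x i) → x ∈ t → y ∈ t) →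
      IsOpen t := fun t ht => isOpen_iff_mem_nhds.2 fun x hx =>
    (nhds_hasBasis x).mem_iff.2 ⟨N, trivial, fun y hy => ht x y hy hx⟩
  exact ⟨⟨key _ fun x y hxy hx hy => hx (h y x (fun i hi => (hxy i hi).symm) hy)⟩, key s h⟩

instance [Finite 𝒜] : CompactSpace (Config 𝒜) :=
  @Pi.compactSpace ℕ (fun _ => 𝒜) (fun _ => ⊥) fun _ => @Finite.compactSpace 𝒜 ⊥ _

theorem mapClusterPt_iff {ι : Type*} {F : Filter ι} {u : ι → Config 𝒜} {z : Config 𝒜} :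
    MapClusterPt z F u ↔ ∀ l : ℕ, ∃ᶠ n in F, ∀ i < l, u n i = z i := by
  rw [(nhds_hasBasis z).mapClusterPt_iff_frequently]
  simp

/-- The configuration obtained from the stream `y` by deleting its first `n` letters. -/
def drop (y : ℕ → 𝒜) (n : ℕ) : Config 𝒜 := fun i => y (n + i)

/-- The set of limits of the shifts of the stream `y`. -/
def streamLimits (y : ℕ → 𝒜) : Set (Config 𝒜) :=
  {z | ∀ l : ℕ, ∃ᶠ n in atTop, ∀ i < l, y (n + i) = z i}

theorem streamLimits_eq (y : ℕ → 𝒜) :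
    streamLimits y = {z | MapClusterPt z atTop (drop y)} := by
  ext z
  exact mapClusterPt_iff.symm

theorem isClosed_streamLimits (y : ℕ → 𝒜) : IsClosed (streamLimits y) := by
  rw [streamLimits_eq]
  exact isClosed_setOfPred_clusterPt (f := map (drop y) atTop)

/-- Openness of `s` turns a limit point in `s` into infinitely many visits; closedness and
compactness turn infinitely many visits into a limit point in `s`. This reduces outer balls to the
recurrence of finite words. -/
theorem inter_streamLimits_nonempty_iff [Finite 𝒜] {s : Set (Config 𝒜)} (hs : IsClopen s)
    (y : ℕ → 𝒜) : (s ∩ streamLimits y).Nonempty ↔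
      ∃ᶠ n in atTop, drop y n ∈ s := by
  rw [streamLimits_eq]
  constructor
  · rintro ⟨z, hz, hzy⟩
    exact mapClusterPt_iff_frequently.1 hzy s (hs.isOpen.mem_nhds hz)
  · intro h
    exact hs.isClosed.isCompact.exists_mapClusterPt_of_frequently h

theorem streamLimits_congr {y y' : ℕ → 𝒜} (h : ∀ᶠ n in atTop, y n = y' n) :
    streamLimits y = streamLimits y' := by
  obtain ⟨N, hN⟩ := eventually_atTop.1 h
  ext z
  refine forall_congr' fun l => ?_
  refine frequently_congr (eventually_atTop.2 ⟨N, fun n hn => ?_⟩)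
  simp +contextual [hN _ (le_trans hn (Nat.le_add_right n _))]

end Topology

end Config

-- Primitive recursive predicates and the radii of ideal balls

section Recursion

variable {α : Type*} [Primcodable α]

theorem PrimrecPred.forall_lt_of_primrec {R : α → ℕ → Prop} {N : α → ℕ}
    (hR : PrimrecPred fun p : α × ℕ => R p.1 p.2) (hN : Primrec N) :
    PrimrecPred fun a => ∀ i < N a, R a i := by
  have h : PrimrecRel fun (i : ℕ) (a : α) => R a i :=
    PrimrecPred.comp hR (Primrec.snd.pair Primrec.fst)
  exact (PrimrecRel.comp h.forall_mem_list (Primrec.list_range.comp hN) Primrec.id).of_eq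
    fun a => by simp

theorem REPred.exists_nat {p : α → ℕ → Prop} (hp : PrimrecPred fun q : α × ℕ => p q.1 q.2) :
    REPred fun a => ∃ n, p a n := by
  classical
  have h : Partrec fun a => Nat.rfind fun n => Part.some (decide (p a n)) :=
    Partrec.rfind hp.computablePred.decide.partrec
  refine h.dom_re.of_eq fun a => Nat.rfind_dom.trans ⟨fun ⟨n, hn, _⟩ => ⟨n, ?_⟩,
    fun ⟨n, hn⟩ => ⟨n, Part.mem_some_iff.2 (by simpa using hn), fun _ => trivial⟩⟩
  simpa using Part.mem_some_iff.1 hn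

end Recursion

section Radius

theorem idealRadius_pos (m : ℕ) : 0 < idealRadius m := by
  unfold idealRadius
  positivity

theorem pow_lt_idealRadius_iff (l m : ℕ) : (1 / 2 : ℝ) ^ l < idealRadius m ↔
    m.unpair.2.unpair.2 + 1 < (m.unpair.2.unpair.1 + 1) * 2 ^ l := by
  rw [idealRadius, one_div, inv_pow, ← one_div, div_lt_div_iff₀ (by positivity) (by positivity),
    one_mul]
  exact_mod_cast Iff.rfl

theorem idealRadius_lt_pow_iff (l m : ℕ) : idealRadius m < (1 / 2 : ℝ) ^ l ↔
    (m.unpair.2.unpair.1 + 1) * 2 ^ l < m.unpair.2.unpair.2 + 1 := by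
  rw [idealRadius, one_div, inv_pow, ← one_div, div_lt_div_iff₀ (by positivity) (by positivity),
    one_mul]
  exact_mod_cast Iff.rfl

theorem lt_of_idealRadius_lt_pow {l m : ℕ} (h : idealRadius m < (1 / 2 : ℝ) ^ l) :
    l < m.unpair.2.unpair.2 + 1 := by
  rw [idealRadius_lt_pow_iff] at h
  have := Nat.lt_two_pow_self (n := l)
  nlinarith [Nat.zero_le (m.unpair.2.unpair.1 * 2 ^ l)]

theorem primrec_radius_num : Primrec fun m : ℕ => m.unpair.2.unpair.1 :=
  Primrec.fst.comp (Primrec.unpair.comp (Primrec.snd.comp Primrec.unpair))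

theorem primrec_radius_den : Primrec fun m : ℕ => m.unpair.2.unpair.2 :=
  Primrec.snd.comp (Primrec.unpair.comp (Primrec.snd.comp Primrec.unpair))

variable {α : Type*} [Primcodable α] {f g : α → ℕ}

theorem primrecPred_pow_lt_idealRadius (hf : Primrec f) (hg : Primrec g) :
    PrimrecPred fun a => (1 / 2 : ℝ) ^ f a < idealRadius (g a) :=
  (Primrec.nat_lt.comp (Primrec.succ.comp (primrec_radius_den.comp hg))
    (Primrec.nat_mul.comp (Primrec.succ.comp (primrec_radius_num.comp hg))
      (Config.primrec_two_pow.comp hf))).of_eq fun _ => (pow_lt_idealRadius_iff _ _).symm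

theorem primrecPred_idealRadius_lt_pow (hf : Primrec f) (hg : Primrec g) :
    PrimrecPred fun a => idealRadius (g a) < (1 / 2 : ℝ) ^ f a :=
  (Primrec.nat_lt.comp (Primrec.nat_mul.comp (Primrec.succ.comp (primrec_radius_num.comp hg))
      (Config.primrec_two_pow.comp hf))
    (Primrec.succ.comp (primrec_radius_den.comp hg))).of_eq
      fun _ => (idealRadius_lt_pow_iff _ _).symm

theorem primrecPred_idealRadius_le_pow (hf : Primrec f) (hg : Primrec g) :
    PrimrecPred fun a => idealRadius (g a) ≤ (1 / 2 : ℝ) ^ f a :=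
  (primrecPred_pow_lt_idealRadius hf hg).not.of_eq fun _ => not_lt

end Radius

-- Effectivity of balls, maps and closed sets

namespace Config

theorem ofWord_map_range {𝒜 : Type*} [Inhabited 𝒜] (x : Config 𝒜) {n i : ℕ} (hi : i < n) :
    (ofWord ((List.range n).map x) : Config 𝒜) i = x i := by
  have aux : ∀ f : ℕ → 𝒜, ((List.range n).map f).getD i default = f i := fun f => by simp [hi]
  exact aux x

section BallIndex

variable {𝒜 : Type*} [Primcodable 𝒜]

/-- The index of the ball of radius `2 ^ (-k)` around the ideal point `v 0^∞`. -/
def ballIndex (v : List 𝒜) (k : ℕ) : ℕ :=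
  Nat.pair (Encodable.encode v) (Nat.pair 0 (2 ^ k - 1))

theorem idealRadius_ballIndex (v : List 𝒜) (k : ℕ) :
    idealRadius (ballIndex v k) = (1 / 2 : ℝ) ^ k := by
  have h : 1 ≤ 2 ^ k := Nat.one_le_two_pow
  simp [ballIndex, idealRadius, Nat.cast_sub h]

theorem primrec_ballIndex {α : Type*} [Primcodable α] {v : α → List 𝒜} {k : α → ℕ}
    (hv : Primrec v) (hk : Primrec k) : Primrec fun a => ballIndex (v a) (k a) :=
  Primrec₂.natPair.comp (Primrec.encode.comp hv) (Primrec₂.natPair.comp (Primrec.const 0)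
    (Primrec.nat_sub.comp (primrec_two_pow.comp hk) (Primrec.const 1)))

theorem primrec_idealWord : Primrec fun n : ℕ => word 𝒜 n.unpair.1 :=
  primrec_word.comp (Primrec.fst.comp Primrec.unpair)

theorem primrec_ofWord [Inhabited 𝒜] : Primrec fun p : List 𝒜 × ℕ => (ofWord p.1 : Config 𝒜) p.2 :=
  (Primrec.list_getD default).comp .fst .snd

end BallIndex

variable {𝒜 : Type*} [Primcodable 𝒜] [Inhabited 𝒜] [DecidableEq 𝒜]

theorem idealCenter_ballIndex (v : List 𝒜) (k : ℕ) :
    idealCenter (Config 𝒜) (ballIndex v k) = ofWord v := by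
  change ofWord (word 𝒜 (ballIndex v k).unpair.1) = ofWord v
  simp [ballIndex, word]

theorem mem_idealBall_ballIndex (x : Config 𝒜) {n k : ℕ} (h : k < n) :
    x ∈ idealBall (Config 𝒜) (ballIndex ((List.range n).map x) k) := by
  rw [idealBall, idealCenter_ballIndex, idealRadius_ballIndex, Metric.mem_ball]
  exact (dist_le_of_forall_lt fun i hi => (ofWord_map_range x hi).symm).trans_lt
    (pow_lt_pow_right_of_lt_one₀ (by norm_num) (by norm_num) h)

theorem apply_eq_of_mem_idealBall {x : Config 𝒜} {n k i : ℕ} (hx : x ∈ idealBall (Config 𝒜) n)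
    (h : idealRadius n ≤ (1 / 2 : ℝ) ^ k) (hi : i ≤ k) : x i = idealCenter (Config 𝒜) n i :=
  apply_eq_of_dist_lt ((Metric.mem_ball.1 hx).trans_le h) hi

theorem mem_idealBall_iff {x : Config 𝒜} {n : ℕ} : x ∈ idealBall (Config 𝒜) n ↔
    ∃ l : ℕ, (1 / 2 : ℝ) ^ l < idealRadius n ∧ ∀ i < l, x i = idealCenter (Config 𝒜) n i :=
  dist_lt_iff (idealRadius_pos n)

/-- The radius is at least `1 / (q + 1)`, with `q = n.unpair.2.unpair.2`, so only coordinates below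
`q + 1` can be constrained. The bound makes membership a finite check and closed balls clopen. -/
theorem mem_closedIdealBall_iff {x : Config 𝒜} {n : ℕ} : x ∈ closedIdealBall (Config 𝒜) n ↔
    ∀ l < n.unpair.2.unpair.2 + 1, idealRadius n < (1 / 2 : ℝ) ^ l →
      x l = idealCenter (Config 𝒜) n l :=
  (dist_le_iff (idealRadius_pos n).le).trans
    ⟨fun h l _ hl => h l hl, fun h l hl => h l (lt_of_idealRadius_lt_pow hl) hl⟩

theorem isClopen_closedIdealBall (n : ℕ) : IsClopen (closedIdealBall (Config 𝒜) n) :=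
  isClopen_of_forall_lt (n.unpair.2.unpair.2 + 1) fun x y hxy hx => by
    rw [mem_closedIdealBall_iff] at hx ⊢
    exact fun l hl h => (hxy l hl).trans (hx l hl h)

theorem mem_closedIdealBall_ballIndex {x : Config 𝒜} {v : List 𝒜} :
    x ∈ closedIdealBall (Config 𝒜) (ballIndex v v.length) ↔
      ∀ i < v.length, x i = v.getD i default := by
  rw [closedIdealBall, idealCenter_ballIndex, idealRadius_ballIndex, Metric.mem_closedBall]
  exact (PiNat.mem_cylinder_iff_dist_le (E := fun _ : ℕ => 𝒜)).symm

theorem primrec_idealCenter {α : Type*} [Primcodable α] {f g : α → ℕ} (hf : Primrec f)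
    (hg : Primrec g) : Primrec fun a => idealCenter (Config 𝒜) (f a) (g a) :=
  primrec_ofWord.comp ((primrec_idealWord.comp hf).pair hg)

/-- A map whose `i`-th output letter depends on the first `N i` input letters, in a primitive
recursive way, is computable. -/
theorem isComputableMap_of_primrec {T : Config 𝒜 → Config 𝒜} {N : ℕ → ℕ} (hN : Primrec N)
    (hmono : Monotone N)
    (hloc : ∀ (x y : Config 𝒜) (i : ℕ), (∀ k < N i, x k = y k) → T x i = T y i)
    (hT : Primrec fun p : List 𝒜 × ℕ => T (ofWord p.1) p.2) : IsComputableMap T := by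
  -- A ball of radius at most `2 ^ (-N l)` fixes the first `N l` letters, so the image of its center
  -- decides the first `l` output letters of all its points.
  refine ⟨fun m => {n | ∃ l : ℕ, (1 / 2 : ℝ) ^ l < idealRadius m ∧
    (∀ i < l, T (idealCenter (Config 𝒜) n) i = idealCenter (Config 𝒜) m i) ∧
    idealRadius n ≤ (1 / 2 : ℝ) ^ N l}, ?_, fun m => ?_⟩
  · refine REPred.exists_nat (p := fun (p : ℕ × ℕ) l => (1 / 2 : ℝ) ^ l < idealRadius p.1 ∧
      (∀ i < l, T (idealCenter (Config 𝒜) p.2) i = idealCenter (Config 𝒜) p.1 i) ∧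
      idealRadius p.2 ≤ (1 / 2 : ℝ) ^ N l) ?_
    refine (primrecPred_pow_lt_idealRadius .snd (.comp .fst .fst)).and (PrimrecPred.and ?_
      (primrecPred_idealRadius_le_pow (hN.comp .snd) (.comp .snd .fst)))
    refine PrimrecPred.forall_lt_of_primrec (R := fun (q : (ℕ × ℕ) × ℕ) i =>
      T (idealCenter (Config 𝒜) q.1.2) i = idealCenter (Config 𝒜) q.1.1 i) ?_ Primrec.snd
    have h1 : Primrec fun q : ((ℕ × ℕ) × ℕ) × ℕ => q.1.1 := Primrec.fst.comp Primrec.fst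
    exact Primrec.eq.comp
      (hT.comp ((primrec_idealWord.comp (Primrec.snd.comp h1)).pair Primrec.snd))
      (primrec_idealCenter (Primrec.fst.comp h1) Primrec.snd)
  · ext x
    simp only [Set.mem_preimage, Set.mem_iUnion, Set.mem_ofPred_eq, exists_prop]
    constructor
    · intro hx
      obtain ⟨l, hl, h⟩ := mem_idealBall_iff.1 hx
      refine ⟨ballIndex ((List.range (N l + 1)).map x) (N l), ⟨l, hl, fun i hi => ?_, ?_⟩,
        mem_idealBall_ballIndex x (Nat.lt_succ_self _)⟩
      · rw [← h i hi, idealCenter_ballIndex]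
        exact hloc _ _ _ fun k hk => ofWord_map_range x
          ((hk.trans_le (hmono hi.le)).trans (Nat.lt_succ_self _))
      · rw [idealRadius_ballIndex]
    · rintro ⟨n, ⟨l, hl, h, hr⟩, hx⟩
      refine mem_idealBall_iff.2 ⟨l, hl, fun i hi => ?_⟩
      rw [← h i hi]
      exact hloc _ _ _ fun k hk =>
        apply_eq_of_mem_idealBall hx hr (hk.le.trans (hmono hi.le))

/-- A full shift over a decidable subalphabet is a computable closed set. -/
theorem isComputableClosed_forall_mem {Q : Set 𝒜} (hQ : PrimrecPred fun a => a ∈ Q)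
    (h0 : default ∈ Q) : IsComputableClosed {x : Config 𝒜 | ∀ i, x i ∈ Q} := by
  have hV : ({x : Config 𝒜 | ∀ i, x i ∈ Q})ᶜ = ⋃ n ∈ {n : ℕ | ∃ l : ℕ,
      idealCenter (Config 𝒜) n l ∉ Q ∧ idealRadius n ≤ (1 / 2 : ℝ) ^ l},
      idealBall (Config 𝒜) n := by
    ext x
    simp only [Set.mem_compl_iff, Set.mem_ofPred_eq, not_forall, Set.mem_iUnion, exists_prop]
    constructor
    · rintro ⟨l, hl⟩
      refine ⟨ballIndex ((List.range (l + 1)).map x) l, ⟨l, ?_, ?_⟩,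
        mem_idealBall_ballIndex x (Nat.lt_succ_self _)⟩
      · rwa [idealCenter_ballIndex, ofWord_map_range x (Nat.lt_succ_self _)]
      · rw [idealRadius_ballIndex]
    · rintro ⟨n, ⟨l, hl, hr⟩, hx⟩
      exact ⟨l, by rwa [apply_eq_of_mem_idealBall hx hr le_rfl]⟩
  refine ⟨?_, ⟨_, ?_, hV⟩, ?_⟩
  · rw [← isOpen_compl_iff, hV]
    exact isOpen_biUnion fun n _ => Metric.isOpen_ball
  · exact REPred.exists_nat (p := fun n l => idealCenter (Config 𝒜) n l ∉ Q ∧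
      idealRadius n ≤ (1 / 2 : ℝ) ^ l)
      ((hQ.comp (primrec_idealCenter .fst .snd)).not.and (primrecPred_idealRadius_le_pow .snd .fst))
  · have : REPred fun n => ∃ l : ℕ, (1 / 2 : ℝ) ^ l < idealRadius n ∧
        ∀ i < l, idealCenter (Config 𝒜) n i ∈ Q := by
      refine REPred.exists_nat (p := fun n l => (1 / 2 : ℝ) ^ l < idealRadius n ∧
        ∀ i < l, idealCenter (Config 𝒜) n i ∈ Q) ?_
      refine (primrecPred_pow_lt_idealRadius .snd .fst).and ?_
      exact PrimrecPred.forall_lt_of_primrec (R := fun (q : ℕ × ℕ) i =>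
        idealCenter (Config 𝒜) q.1 i ∈ Q)
        (hQ.comp (primrec_idealCenter (.comp .fst .fst) .snd)) Primrec.snd
    refine this.of_eq fun n => ?_
    constructor
    · rintro ⟨l, hl, h⟩
      -- The prefix of the center is completed by `default`, which lies in `Q`.
      refine ⟨fun i => if i < l then idealCenter (Config 𝒜) n i else default,
        mem_idealBall_iff.2 ⟨l, hl, fun i hi => if_pos hi⟩, fun i => ?_⟩
      dsimp only
      split_ifs with hi
      · exact h i hi
      · exact h0
    · rintro ⟨x, hx, hxQ⟩
      obtain ⟨l, hl, h⟩ := mem_idealBall_iff.1 hx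
      exact ⟨l, hl, fun i hi => h i hi ▸ hxQ i⟩

theorem mem_outerBalls_streamLimits [Finite 𝒜] (y : ℕ → 𝒜) (n : ℕ) :
    n ∈ outerBalls (streamLimits y) ↔
      ¬ ∃ᶠ k in atTop, drop y k ∈ closedIdealBall (Config 𝒜) n := by
  rw [← inter_streamLimits_nonempty_iff (isClopen_closedIdealBall n), Set.not_nonempty_iff_eq_empty]
  rfl

/-- The set of limits of the shifts of a primitive recursive stream is `Π₂`. -/
theorem isPiTwo_streamLimits [Finite 𝒜] {y : ℕ → 𝒜} (hy : Primrec y) :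
    IsPiTwo (streamLimits y) := by
  classical
  refine ⟨(isClosed_streamLimits y).isCompact, ?_⟩
  -- The `Σ₂` form of avoiding a ball: there is `a` such that for all `b` the window at `a + b` lies
  -- outside the closed ball.
  have hP : PrimrecPred fun p : ℕ × ℕ × ℕ =>
      ¬ ∀ l < p.1.unpair.2.unpair.2 + 1, idealRadius p.1 < (1 / 2 : ℝ) ^ l →
        y (p.2.1 + p.2.2 + l) = idealCenter (Config 𝒜) p.1 l := by
    refine (PrimrecPred.forall_lt_of_primrec (R := fun (p : ℕ × ℕ × ℕ) l =>
      idealRadius p.1 < (1 / 2 : ℝ) ^ l →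
        y (p.2.1 + p.2.2 + l) = idealCenter (Config 𝒜) p.1 l) ?_
      (Primrec.succ.comp (primrec_radius_den.comp .fst))).not
    have h1 : PrimrecPred fun q : (ℕ × ℕ × ℕ) × ℕ => idealRadius q.1.1 < (1 / 2 : ℝ) ^ q.2 :=
      primrecPred_idealRadius_lt_pow .snd (.comp .fst .fst)
    have h3 : Primrec fun q : (ℕ × ℕ × ℕ) × ℕ => q.1.2 := .comp .snd .fst
    have h2 : PrimrecPred fun q : (ℕ × ℕ × ℕ) × ℕ =>
        y (q.1.2.1 + q.1.2.2 + q.2) = idealCenter (Config 𝒜) q.1.1 q.2 :=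
      Primrec.eq.comp (hy.comp (Primrec.nat_add.comp
        (Primrec.nat_add.comp (Primrec.fst.comp h3) (Primrec.snd.comp h3)) .snd))
        (primrec_idealCenter (.comp .fst .fst) .snd)
    exact (h1.not.or h2).of_eq fun q => imp_iff_not_or.symm
  refine ⟨_, hP.computablePred.decide, fun i => ?_⟩
  rw [mem_outerBalls_streamLimits, not_frequently, eventually_atTop]
  refine exists_congr fun a => ?_
  simp only [mem_closedIdealBall_iff, decide_eq_true_eq, drop]
  refine ⟨fun h b => h (a + b) (Nat.le_add_right a b), fun h b hb => ?_⟩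
  have := h (b - a)
  rwa [Nat.add_sub_cancel' hb] at this

end Config

/-- The logarithm is found by a bounded search for the least `k` with `n < 2 ^ (k + 1)`. -/
theorem Primrec.nat_log_two : Primrec fun n : ℕ => Nat.log 2 n := by
  refine (Primrec.list_findIdx (f := fun n : ℕ => List.range (n + 1))
    (p := fun n k => decide (n < 2 ^ (k + 1))) (Primrec.list_range.comp Primrec.succ) ?_).of_eq
    fun n => ?_
  · exact (Primrec.nat_lt.comp Primrec.fst
      (Config.primrec_two_pow.comp (Primrec.succ.comp Primrec.snd))).decide
  · have h1 : n < 2 ^ (Nat.log 2 n + 1) := Nat.lt_pow_succ_log_self one_lt_two n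
    have h2 : Nat.log 2 n < (List.range (n + 1)).length := by
      simpa using Nat.lt_succ_of_le (Nat.log_le_self 2 n)
    rw [List.findIdx_eq h2]
    refine ⟨by simpa using h1, fun j hj => ?_⟩
    simpa using Nat.pow_le_of_le_log (b := 2) (by rintro rfl; simp at hj) hj

-- The mixing map and its orbits

namespace Config

/-- The configuration `x` satisfies the rare event `n`: the first layer of `x` vanishes on the whole
interval `[2 ^ (n + 1), 2 ^ (n + 2))`. -/
def IsRare (n : ℕ) (x : Config Letter) : Prop :=
  ∀ i < 2 ^ (n + 2), 2 ^ (n + 1) ≤ i → (x i).1 = 0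

open Classical in
/-- The stream that follows `R` on the dyadic blocks `[2 ^ n, 2 ^ (n + 1))` for which `x` satisfies
the rare event `n`, and `D` on the others. -/
noncomputable def mixture (D R : ℕ → Letter) (x : Config Letter) (p : ℕ) : Letter :=
  if IsRare (Nat.log 2 p) x then R p else D p

/-- The head of a configuration consists of the letters before the first one with second layer `1`.
The map shifts the head and appends two letters of the mixture to it, at the cost of one letter of
the tail; the first layer of the rest of the tail stays in place. -/
noncomputable def mixMap (D R : ℕ → Letter) (x : Config Letter) : Config Letter := fun i =>
  if ∀ k < i + 2, (x k).2 = 0 then x (i + 1)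
  else if ∀ k < i + 1, (x k).2 = 0 then mixture D R x (2 * i + 2)
  else if ∀ k < i, (x k).2 = 0 then mixture D R x (2 * i + 1)
  else ((x i).1, 1)

section Computability

theorem isRare_congr_of_lt {n : ℕ} {x y : Config Letter}
    (h : ∀ k < 2 ^ (n + 2), x k = y k) : IsRare n x ↔ IsRare n y :=
  forall₂_congr fun i hi => by rw [h i hi]

theorem mixture_congr {D R : ℕ → Letter} {x y : Config Letter} {p : ℕ} (hp : p ≠ 0)
    (h : ∀ k < 4 * p, x k = y k) : mixture D R x p = mixture D R y p := by
  have h2 : 2 ^ (Nat.log 2 p + 2) ≤ 4 * p := by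
    have := Nat.pow_log_le_self 2 hp
    rw [pow_add]
    omega
  rw [mixture, mixture, isRare_congr_of_lt fun k hk => h k (hk.trans_le h2)]

/-- The letter appended with the largest index is the mixture at `2 * i + 2`, which reads `x` below
`4 * (2 * i + 2)`. -/
theorem mixMap_congr {D R : ℕ → Letter} {x y : Config Letter} {i : ℕ}
    (h : ∀ k < 8 * i + 8, x k = y k) : mixMap D R x i = mixMap D R y i := by
  have hq : ∀ m ≤ 8 * i + 8, (∀ k < m, (x k).2 = 0) ↔ ∀ k < m, (y k).2 = 0 := fun m hm =>
    forall₂_congr fun k hk => by rw [h k (hk.trans_le hm)]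
  simp only [mixMap, hq (i + 2) (by omega), hq (i + 1) (by omega), hq i (by omega),
    h i (by omega), h (i + 1) (by omega),
    mixture_congr (D := D) (R := R) (p := 2 * i + 2) (by omega) fun k hk => h k (by omega),
    mixture_congr (D := D) (R := R) (p := 2 * i + 1) (by omega) fun k hk => h k (by omega)]

theorem primrecPred_isRare {α : Type*} [Primcodable α] {v : α → List Letter} {n : α → ℕ}
    (hv : Primrec v) (hn : Primrec n) : PrimrecPred fun a => IsRare (n a) (ofWord (v a)) := by
  have h0 : Primrec fun q : α × ℕ => n q.1 := hn.comp .fst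
  have h1 : PrimrecPred fun q : α × ℕ => 2 ^ (n q.1 + 1) ≤ q.2 :=
    Primrec.nat_le.comp (primrec_two_pow.comp (Primrec.succ.comp h0)) .snd
  have h2 : PrimrecPred fun q : α × ℕ => ((ofWord (v q.1) : Config Letter) q.2).1 = 0 :=
    Primrec.eq.comp (Primrec.fst.comp (primrec_ofWord.comp ((hv.comp .fst).pair .snd)))
      (Primrec.const 0)
  exact PrimrecPred.forall_lt_of_primrec (R := fun a i => 2 ^ (n a + 1) ≤ i →
      ((ofWord (v a) : Config Letter) i).1 = 0)
    ((h1.not.or h2).of_eq fun q => imp_iff_not_or.symm)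
    (primrec_two_pow.comp (Primrec.succ.comp (Primrec.succ.comp hn)))

variable {D R : ℕ → Letter}

theorem primrec_mixture (hD : Primrec D) (hR : Primrec R) {α : Type*} [Primcodable α]
    {v : α → List Letter} {p : α → ℕ} (hv : Primrec v) (hp : Primrec p) :
    Primrec fun a => mixture D R (ofWord (v a)) (p a) := by
  classical
  exact (Primrec.ite (primrecPred_isRare hv (Primrec.nat_log_two.comp hp)) (hR.comp hp)
    (hD.comp hp)).of_eq fun a => by rw [mixture]

theorem primrec_mixMap (hD : Primrec D) (hR : Primrec R) :
    Primrec fun p : List Letter × ℕ => mixMap D R (ofWord p.1) p.2 := by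
  classical
  have hq : ∀ c : ℕ, PrimrecPred fun p : List Letter × ℕ =>
      ∀ k < p.2 + c, ((ofWord p.1 : Config Letter) k).2 = 0 := fun c =>
    PrimrecPred.forall_lt_of_primrec
      (R := fun (p : List Letter × ℕ) k => ((ofWord p.1 : Config Letter) k).2 = 0)
      (Primrec.eq.comp (Primrec.snd.comp (primrec_ofWord.comp
        ((Primrec.fst.comp .fst).pair .snd))) (Primrec.const 0))
      (Primrec.nat_add.comp .snd (Primrec.const c))
  have hd : Primrec fun p : List Letter × ℕ => 2 * p.2 :=
    Primrec.nat_mul.comp (Primrec.const 2) .snd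
  exact (Primrec.ite (hq 2) (primrec_ofWord.comp (Primrec.fst.pair (Primrec.succ.comp .snd)))
    (Primrec.ite (hq 1) (primrec_mixture hD hR .fst (Primrec.succ.comp (Primrec.succ.comp hd)))
      (Primrec.ite (hq 0) (primrec_mixture hD hR .fst (Primrec.succ.comp hd))
        ((Primrec.fst.comp primrec_ofWord).pair (Primrec.const 1))))).of_eq fun p => by
    simp only [mixMap, Nat.add_zero, Nat.succ_eq_add_one]

theorem isComputableMap_mixMap (hD : Primrec D) (hR : Primrec R) :
    IsComputableMap (mixMap D R) :=
  isComputableMap_of_primrec (N := fun i => 8 * i + 8)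
    (Primrec.nat_add.comp (Primrec.nat_mul.comp (Primrec.const 8) .id) (Primrec.const 8))
    (fun i j h => by dsimp only; omega) (fun _ _ _ h => mixMap_congr h) (primrec_mixMap hD hR)

end Computability

section Dynamics

variable {D R : ℕ → Letter} {x : Config Letter} {L : ℕ}

theorem mixMap_of_add_one_lt (h0 : ∀ k < L, (x k).2 = 0) {i : ℕ} (hi : i + 1 < L) :
    mixMap D R x i = x (i + 1) :=
  if_pos fun k hk => h0 k (by omega)

theorem mixMap_of_add_one_eq (h0 : ∀ k < L, (x k).2 = 0) (h1 : (x L).2 = 1) {i : ℕ}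
    (hi : i + 1 = L) : mixMap D R x i = mixture D R x (2 * L) := by
  rw [mixMap, if_neg fun h => by simpa [h1] using h L (by omega),
    if_pos fun k hk => h0 k (by omega), ← hi]
  rfl

theorem mixMap_of_eq (h0 : ∀ k < L, (x k).2 = 0) (h1 : (x L).2 = 1) :
    mixMap D R x L = mixture D R x (2 * L + 1) := by
  rw [mixMap, if_neg fun h => by simpa [h1] using h L (by omega),
    if_neg fun h => by simpa [h1] using h L (by omega), if_pos h0]

theorem mixMap_of_lt (h1 : (x L).2 = 1) {i : ℕ} (hi : L < i) :
    mixMap D R x i = ((x i).1, 1) := by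
  rw [mixMap, if_neg fun h => by simpa [h1] using h L (by omega),
    if_neg fun h => by simpa [h1] using h L (by omega),
    if_neg fun h => by simpa [h1] using h L hi]

/-- The rare event for the block of `p` is read from the next dyadic interval, strictly beyond `p`.
This is what lets the decision be made from the tail, which the dynamics has not yet touched. -/
theorem mixture_congr_fst {y : Config Letter} {p : ℕ} (h : ∀ k, p < k → (x k).1 = (y k).1) :
    mixture D R x p = mixture D R y p := by
  have : IsRare (Nat.log 2 p) x ↔ IsRare (Nat.log 2 p) y :=
    forall₃_congr fun i _ hi => by
      rw [h i ((Nat.lt_pow_succ_log_self one_lt_two p).trans_le hi)]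
  rw [mixture, mixture, this]

theorem mixture_snd (hD : ∀ n, (D n).2 = 0) (hR : ∀ n, (R n).2 = 0) (p : ℕ) :
    (mixture D R x p).2 = 0 := by
  rw [mixture]
  split_ifs
  exacts [hR p, hD p]

/-- Four invariants carried together: the head has length `L + n`, it is followed by a marker, the
first layer from there on is original, and the part of the head not inherited from `x` is a window
of the mixture. The letters added at time `n` have indices `2 * (L + n)` and `2 * (L + n) + 1`, so
their rare events depend only on the original tail. -/
theorem iterate_mixMap (hD : ∀ n, (D n).2 = 0) (hR : ∀ n, (R n).2 = 0)
    (h0 : ∀ k < L, (x k).2 = 0) (h1 : (x L).2 = 1) (n : ℕ) :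
    (∀ k < L + n, ((mixMap D R)^[n] x k).2 = 0) ∧ ((mixMap D R)^[n] x (L + n)).2 = 1 ∧
    (∀ k, L + n ≤ k → ((mixMap D R)^[n] x k).1 = (x k).1) ∧
    ∀ k < L + n, L ≤ n + k → (mixMap D R)^[n] x k = mixture D R x (n + L + k) := by
  induction n with
  | zero => exact ⟨h0, h1, fun _ _ => rfl, fun k hk hk' => absurd hk' (by omega)⟩
  | succ n ih =>
    obtain ⟨ha, hb, hc, hd⟩ := ih
    rw [Function.iterate_succ_apply']
    generalize (mixMap D R)^[n] x = y at ha hb hc hd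
    have hmix : ∀ p, L + n ≤ p → mixture D R y p = mixture D R x p := fun p hp =>
      mixture_congr_fst fun k hk => hc k (by omega)
    refine ⟨fun k hk => ?_, ?_, fun k hk => ?_, fun k hk hk' => ?_⟩
    · rcases lt_trichotomy (k + 1) (L + n) with h | h | h
      · rw [mixMap_of_add_one_lt ha h]
        exact ha _ h
      · rw [mixMap_of_add_one_eq ha hb h]
        exact mixture_snd hD hR _
      · obtain rfl : k = L + n := by omega
        rw [mixMap_of_eq ha hb]
        exact mixture_snd hD hR _
    · rw [mixMap_of_lt hb (by omega)]
    · rw [mixMap_of_lt hb (by omega)]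
      exact hc k (by omega)
    · rcases lt_trichotomy (k + 1) (L + n) with h | h | h
      · rw [mixMap_of_add_one_lt ha h, hd _ h (by omega)]
        congr 1
        omega
      · rw [mixMap_of_add_one_eq ha hb h, hmix _ (by omega)]
        congr 1
        omega
      · obtain rfl : k = L + n := by omega
        rw [mixMap_of_eq ha hb, hmix _ (by omega)]
        congr 1
        omega

theorem omegaSet_mixMap (hD : ∀ n, (D n).2 = 0) (hR : ∀ n, (R n).2 = 0)
    (hx : ∃ k, (x k).2 = 1) : omegaSet (mixMap D R) x = streamLimits (mixture D R x) := by
  classical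
  have h1 := Nat.find_spec hx
  have h0 : ∀ k < Nat.find hx, (x k).2 = 0 := fun k hk => by
    have := Nat.find_min hx hk
    omega
  generalize Nat.find hx = L at h0 h1
  ext z
  refine mapClusterPt_iff.trans (forall_congr' fun l => ?_)
  -- Time `n` shows the mixture from position `n + L` on; once `n ≥ L + l`, the first `l` letters
  -- are no longer inherited from the head of `x`.
  conv_rhs => rw [← map_add_atTop_eq_nat L, frequently_map]
  refine frequently_congr (eventually_atTop.2 ⟨L + l, fun n hn => forall₂_congr fun i hi => ?_⟩)
  rw [(iterate_mixMap hD hR h0 h1 n).2.2.2 i (by omega) (by omega)]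

end Dynamics

end Config

/-- Minimality is automatic: a point whose limit set is all of `A` is not in the realm of a proper
subset of `A`. -/
theorem isMetricAttractor_of_ae_omegaSet_eq {X : Type*} [TopologicalSpace X] [MeasurableSpace X]
    {μ : Measure X} {T : X → X} {A : Set X} (hA : IsClosed A) (h : ∀ᵐ x ∂μ, omegaSet T x = A) :
    IsMetricAttractor μ T A := by
  refine ⟨hA, h.mono fun x hx => hx.subset, fun A' _ hA' hpos => hpos.ne' ?_⟩
  refine measure_mono_null (t := {x | ¬ omegaSet T x = A}) (fun x hx hxA => ?_) (ae_iff.1 h)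
  have hx : omegaSet T x ⊆ A' := hx
  exact hA'.2 (hxA ▸ hx)

theorem isTopologicalAttractor_of_residual_omegaSet_eq {X : Type*} [TopologicalSpace X]
    {T : X → X} {A : Set X} (hA : IsClosed A) (h : ∀ᶠ x in residual X, omegaSet T x = A) :
    IsTopologicalAttractor T A := by
  refine ⟨hA, h.mono fun x hx => hx.subset, fun A' _ hA' => ?_⟩
  exact h.mono fun x hx hxA => hA'.2 (hx ▸ hxA)

namespace Config

-- Almost sure behaviour

section Measure

theorem uniformBernoulli_forall_mem (s : Finset ℕ) (Q : Set Letter) :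
    uniformBernoulli Letter {x | ∀ i ∈ s, x i ∈ Q} =
      (PMF.uniformOfFintype Letter).toMeasure Q ^ s.card := by
  have h := Measure.infinitePi_pi (fun _ : ℕ => (PMF.uniformOfFintype Letter).toMeasure)
    (s := s) (t := fun _ => Q) fun _ _ => MeasurableSet.of_discrete
  rw [Finset.prod_const] at h
  exact h

theorem uniform_fst_eq_zero_lt_one :
    (PMF.uniformOfFintype Letter).toMeasure {c | c.1 = 0} < 1 := by
  rw [PMF.toMeasure_uniformOfFintype_apply _ MeasurableSet.of_discrete]
  have h : Fintype.card {c : Letter | c.1 = 0} = 2 := by decide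
  rw [ENNReal.div_lt_iff (by simp) (by simp)]
  simp only [h, Fintype.card_prod, Fintype.card_fin]
  norm_num

theorem uniform_snd_eq_zero_lt_one :
    (PMF.uniformOfFintype Letter).toMeasure {c | c.2 = 0} < 1 := by
  rw [PMF.toMeasure_uniformOfFintype_apply _ MeasurableSet.of_discrete]
  have h : Fintype.card {c : Letter | c.2 = 0} = 3 := by decide
  rw [ENNReal.div_lt_iff (by simp) (by simp)]
  simp only [h, Fintype.card_prod, Fintype.card_fin]
  norm_num

theorem ae_exists_snd_eq_one : ∀ᵐ x ∂uniformBernoulli Letter, ∃ k, (x k).2 = 1 := by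
  rw [ae_iff]
  refine le_antisymm (ge_of_tendsto'
    (ENNReal.tendsto_pow_atTop_nhds_zero_of_lt_one uniform_snd_eq_zero_lt_one) fun n => ?_) bot_le
  have h := uniformBernoulli_forall_mem (Finset.range n) {c | c.2 = 0}
  rw [Finset.card_range] at h
  rw [← h]
  refine measure_mono fun x hx i _ => ?_
  have hx' : ¬ (x i).2 = 1 := fun h1 => hx ⟨i, h1⟩
  change (x i).2 = 0
  omega

/-- The event constrains `2 ^ (n + 1)` independent letters; keeping `n` of them already gives a
convergent geometric series. -/
theorem uniformBernoulli_isRare_le (n : ℕ) : uniformBernoulli Letter {x | IsRare n x} ≤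
    (PMF.uniformOfFintype Letter).toMeasure {c | c.1 = 0} ^ n := by
  have h := uniformBernoulli_forall_mem (Finset.Ico (2 ^ (n + 1)) (2 ^ (n + 2))) {c | c.1 = 0}
  refine ((measure_mono fun x hx i hi => ?_).trans h.le).trans
    (pow_le_pow_right_of_le_one' uniform_fst_eq_zero_lt_one.le ?_)
  · rw [Finset.mem_Ico] at hi
    exact hx i hi.2 hi.1
  · rw [Nat.card_Ico]
    have := Nat.lt_two_pow_self (n := n)
    rw [pow_add, pow_add]
    omega

theorem ae_eventually_not_isRare :
    ∀ᵐ x ∂uniformBernoulli Letter, ∀ᶠ n in atTop, ¬ IsRare n x := by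
  refine ae_eventually_notMem (s := fun n => {x | IsRare n x}) (ne_top_of_le_ne_top ?_
    (ENNReal.tsum_le_tsum uniformBernoulli_isRare_le))
  rw [ENNReal.tsum_geometric]
  exact ENNReal.inv_ne_top.2 (tsub_pos_of_lt uniform_fst_eq_zero_lt_one).ne'

theorem tendsto_nat_log_two : Tendsto (fun n : ℕ => Nat.log 2 n) atTop atTop :=
  tendsto_atTop.2 fun k => eventually_atTop.2
    ⟨2 ^ k, fun _ hn => Nat.le_log_of_pow_le one_lt_two hn⟩

variable {D R : ℕ → Letter}

theorem ae_omegaSet_mixMap (hD : ∀ n, (D n).2 = 0) (hR : ∀ n, (R n).2 = 0) :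
    ∀ᵐ x ∂uniformBernoulli Letter, omegaSet (mixMap D R) x = streamLimits D := by
  filter_upwards [ae_exists_snd_eq_one, ae_eventually_not_isRare] with x hx hrare
  rw [omegaSet_mixMap hD hR hx]
  exact streamLimits_congr ((tendsto_nat_log_two.eventually hrare).mono fun p hp => if_neg hp)

end Measure

-- Generic behaviour

section Category

theorem dense_of_forall_exists {s : Set (Config Letter)}
    (h : ∀ (x : Config Letter) (l : ℕ), ∃ y ∈ s, ∀ i < l, y i = x i) : Dense s := fun x => by
  rw [mem_closure_iff_nhds_basis (nhds_hasBasis x)]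
  exact fun l _ => h x l

theorem residual_exists_snd_eq_one : ∀ᶠ x in residual (Config Letter), ∃ k, (x k).2 = 1 := by
  refine residual_of_dense_open ?_ (dense_of_forall_exists fun x l =>
    ⟨fun i => if i < l then x i else (0, 1), ⟨l, by simp⟩, fun i hi => if_pos hi⟩)
  have : {x : Config Letter | ∃ k, (x k).2 = 1} = ⋃ k, {x | (x k).2 = 1} := by
    ext
    simp
  rw [this]
  exact isOpen_iUnion fun k => (isClopen_of_forall_lt (k + 1) fun x y hxy hx => by
    change (y k).2 = 1
    rwa [hxy k (Nat.lt_succ_self k)]).isOpen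

/-- The set `N` is needed because a given word of `R` may occur only in sparse blocks. Any cylinder
can be continued by zeros from a far position `2 ^ (n + 1)` with `n ∈ N`, which gives density. -/
theorem residual_frequently_isRare {N : Set ℕ} (hN : ∃ᶠ n in atTop, n ∈ N) :
    ∀ᶠ x in residual (Config Letter), ∃ᶠ n in atTop, n ∈ N ∧ IsRare n x := by
  simp only [frequently_atTop, eventually_countable_forall]
  intro a
  refine residual_of_dense_open ?_ (dense_of_forall_exists fun x l => ?_)
  · have : {x : Config Letter | ∃ b ≥ a, b ∈ N ∧ IsRare b x} =
        ⋃ b ∈ {b | a ≤ b ∧ b ∈ N}, {x | IsRare b x} := by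
      ext
      simp [and_assoc]
    rw [this]
    exact isOpen_biUnion fun b _ => (isClopen_of_forall_lt (2 ^ (b + 2)) fun x y hxy hx =>
      (isRare_congr_of_lt hxy).2 hx).isOpen
  · obtain ⟨n, hn, hnN⟩ := frequently_atTop.1 hN (max a l)
    refine ⟨fun i => if i < 2 ^ (n + 1) then x i else 0,
      ⟨n, le_of_max_le_left hn, hnN, fun i _ hi => ?_⟩, fun i hi => if_pos ?_⟩
    · simp [not_lt.2 hi]
    · exact (hi.trans_le (le_of_max_le_right hn)).trans
        (Nat.lt_two_pow_self.trans (Nat.pow_lt_pow_succ one_lt_two))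

/-- The indices of the dyadic blocks in which the word `u` occurs in the stream `R`. -/
def blocksWith (R : ℕ → Letter) (u : List Letter) : Set ℕ :=
  {n | ∃ p, 2 ^ n ≤ p ∧ p + u.length ≤ 2 ^ (n + 1) ∧ ∀ i < u.length, R (p + i) = u.getD i default}

theorem mem_blocksWith_map_range {R : ℕ → Letter} {z : ℕ → Letter} {l n : ℕ} :
    n ∈ blocksWith R ((List.range l).map z) ↔
      ∃ p, 2 ^ n ≤ p ∧ p + l ≤ 2 ^ (n + 1) ∧ ∀ i < l, R (p + i) = z i := by
  simp only [blocksWith, Set.mem_ofPred_eq, List.length_map, List.length_range]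
  refine exists_congr fun p => and_congr_right fun _ => and_congr_right fun _ =>
    forall₂_congr fun i hi => ?_
  simp [hi]

variable {D R : ℕ → Letter}

theorem residual_omegaSet_mixMap (hD : ∀ n, (D n).2 = 0) (hR : ∀ n, (R n).2 = 0) :
    ∀ᶠ x in residual (Config Letter), omegaSet (mixMap D R) x = streamLimits (mixture D R x) ∧
      {z : Config Letter | ∀ l, ∃ᶠ n in atTop, n ∈ blocksWith R ((List.range l).map z)} ⊆
        streamLimits (mixture D R x) := by
  -- There are countably many words, so one generic set serves all of them and hence all limit
  -- points `z` at once.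
  have h : ∀ᶠ x in residual (Config Letter), ∀ u : List Letter,
      (∃ᶠ n in atTop, n ∈ blocksWith R u) → ∃ᶠ n in atTop, n ∈ blocksWith R u ∧ IsRare n x :=
    eventually_countable_forall.2 fun u => by
      by_cases hu : ∃ᶠ n in atTop, n ∈ blocksWith R u
      · exact (residual_frequently_isRare hu).mono fun x hx _ => hx
      · exact Eventually.of_forall fun x hx => absurd hx hu
  filter_upwards [residual_exists_snd_eq_one, h] with x hx hrare
  refine ⟨omegaSet_mixMap hD hR hx, fun z hz l => frequently_atTop.2 fun a => ?_⟩
  obtain ⟨n, hn, hnz, hnx⟩ := frequently_atTop.1 (hrare _ (hz l)) a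
  obtain ⟨p, hp, hpl, hpz⟩ := mem_blocksWith_map_range.1 hnz
  refine ⟨p, hn.trans (Nat.lt_two_pow_self.le.trans hp), fun i hi => ?_⟩
  have hlog : Nat.log 2 (p + i) = n :=
    (Nat.log_eq_iff (Or.inr ⟨one_lt_two, by have := Nat.two_pow_pos n; omega⟩)).2
      ⟨by omega, by omega⟩
  rw [← hpz i hi, mixture, hlog, if_pos hnx]

end Category

end Config

-- Totality of codes as a recurrence property

section Stages

open Nat.Partrec (Code)

/-- The code `e` halts on all inputs up to `a` within the bound `k`. -/
def HaltsUpTo (e a k : ℕ) : Prop :=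
  ∀ i < a + 1, (Code.evaln k (Denumerable.ofNat Code e) i).isSome

/-- `k` is the least bound within which the code `e` halts on all inputs up to `a`. -/
def IsHaltingStage (e a k : ℕ) : Prop :=
  HaltsUpTo e a k ∧ ∀ j < k, ¬ HaltsUpTo e a j

open Classical in
/-- A sequence of natural numbers that takes the value `e + 1` infinitely often exactly when the
code `e` is total. -/
noncomputable def stageCode (n : ℕ) : ℕ :=
  if IsHaltingStage n.unpair.1 n.unpair.2.unpair.1 n.unpair.2.unpair.2 then n.unpair.1 + 1 else 0

theorem stageCode_le (n : ℕ) : stageCode n ≤ n + 1 := by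
  rw [stageCode]
  have := Nat.unpair_left_le n
  split_ifs <;> omega

theorem primrecPred_haltsUpTo : PrimrecPred fun p : ℕ × ℕ × ℕ => HaltsUpTo p.1 p.2.1 p.2.2 := by
  have h1 : Primrec fun q : (ℕ × ℕ × ℕ) × ℕ =>
      Code.evaln q.1.2.2 (Denumerable.ofNat Code q.1.1) q.2 :=
    Code.primrec_evaln.comp (((Primrec.snd.comp (Primrec.snd.comp .fst)).pair
      ((Primrec.ofNat Code).comp (Primrec.fst.comp .fst))).pair .snd)
  exact PrimrecPred.forall_lt_of_primrec
    (R := fun (p : ℕ × ℕ × ℕ) i => (Code.evaln p.2.2 (Denumerable.ofNat Code p.1) i).isSome)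
    ((Primrec.eq.comp (Primrec.option_isSome.comp h1) (Primrec.const true)))
    (Primrec.succ.comp (Primrec.fst.comp .snd))

theorem primrecPred_isHaltingStage :
    PrimrecPred fun p : ℕ × ℕ × ℕ => IsHaltingStage p.1 p.2.1 p.2.2 := by
  refine primrecPred_haltsUpTo.and ?_
  exact PrimrecPred.forall_lt_of_primrec
    (R := fun (p : ℕ × ℕ × ℕ) j => ¬ HaltsUpTo p.1 p.2.1 j)
    (primrecPred_haltsUpTo.comp ((Primrec.fst.comp .fst).pair
      ((Primrec.fst.comp (Primrec.snd.comp .fst)).pair .snd))).not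
    (Primrec.snd.comp .snd)

theorem primrec_stageCode : Primrec stageCode := by
  classical
  have h1 : Primrec fun n : ℕ => n.unpair.1 := Primrec.fst.comp Primrec.unpair
  exact (Primrec.ite (primrecPred_isHaltingStage.comp
    (h1.pair (primrec_radius_num.pair primrec_radius_den))) (Primrec.succ.comp h1)
    (Primrec.const 0)).of_eq fun n => by rw [stageCode]

theorem IsHaltingStage.eq {e a k k' : ℕ} (h : IsHaltingStage e a k)
    (h' : IsHaltingStage e a k') : k = k' :=
  le_antisymm (not_lt.1 fun hk => h.2 _ hk h'.1) (not_lt.1 fun hk => h'.2 _ hk h.1)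

theorem exists_isHaltingStage {e : ℕ} (h : ∀ i, ((Denumerable.ofNat Code e).eval i).Dom) (a : ℕ) :
    ∃ k, IsHaltingStage e a k := by
  classical
  have h1 : ∀ i, ∃ k, (Code.evaln k (Denumerable.ofNat Code e) i).isSome := fun i => by
    obtain ⟨y, hy⟩ := Part.dom_iff_mem.1 (h i)
    obtain ⟨k, hk⟩ := Code.evaln_complete.1 hy
    exact ⟨k, Option.isSome_iff_exists.2 ⟨y, hk⟩⟩
  choose K hK using h1
  have h2 : ∃ k, HaltsUpTo e a k := by
    refine ⟨(Finset.range (a + 1)).sup K, fun i hi => ?_⟩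
    obtain ⟨y, hy⟩ := Option.isSome_iff_exists.1 (hK i)
    exact Option.isSome_iff_exists.2
      ⟨y, Code.evaln_mono (Finset.le_sup (Finset.mem_range.2 hi)) hy⟩
  exact ⟨Nat.find h2, Nat.find_spec h2, fun j hj => Nat.find_min h2 hj⟩

/-- For each `a` at most one `k` is a halting stage. A total code has one for every `a`; a code
diverging at `a` has none from `a` on, hence finitely many in all. -/
theorem frequently_stageCode_eq_iff (e : ℕ) : (∃ᶠ n in atTop, stageCode n = e + 1) ↔
    ∀ a, ((Denumerable.ofNat Code e).eval a).Dom := by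
  classical
  constructor
  · intro h a
    by_contra ha
    -- `sInf` names the halting stage of each `b < a`; where none exists its default value only
    -- enlarges the finite set.
    refine Nat.frequently_atTop_iff_infinite.1 h (Set.Finite.subset
      ((Finset.range a).image fun b => Nat.pair e (Nat.pair b
        (sInf {k | IsHaltingStage e b k}))).finite_toSet fun n hn => ?_)
    have hn : stageCode n = e + 1 := hn
    rw [stageCode] at hn
    split_ifs at hn with hs
    have he : n.unpair.1 = e := by omega
    rw [he] at hs
    have hk : sInf {k | IsHaltingStage e n.unpair.2.unpair.1 k} = n.unpair.2.unpair.2 :=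
      (Nat.sInf_mem (s := {k | IsHaltingStage e n.unpair.2.unpair.1 k}) ⟨_, hs⟩).eq hs
    simp only [Finset.coe_image, Set.mem_image, Finset.coe_range, Set.mem_Iio]
    refine ⟨n.unpair.2.unpair.1, not_le.1 fun hle => ha ?_, ?_⟩
    · obtain ⟨y, hy⟩ := Option.isSome_iff_exists.1 (hs.1 a (by omega))
      exact Part.dom_iff_mem.2 ⟨y, Code.evaln_sound hy⟩
    · rw [hk, Nat.pair_unpair, ← he, Nat.pair_unpair]
  · refine fun h => frequently_atTop.2 fun a => ?_
    obtain ⟨k, hk⟩ := exists_isHaltingStage h a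
    refine ⟨Nat.pair e (Nat.pair a k),
      (Nat.left_le_pair a k).trans (Nat.right_le_pair e _), ?_⟩
    simp [stageCode, hk]

/-- Totality of codes is a complete `Π₂` property. -/
theorem IsSigmaTwo.exists_primrec_code {B : Set ℕ} (hB : IsSigmaTwo B) :
    ∃ g : ℕ → ℕ, Primrec g ∧
      ∀ n, n ∈ B ↔ ¬ ∀ a, ((Denumerable.ofNat Code (g n)).eval a).Dom := by
  obtain ⟨f, hf, hB⟩ := hB
  -- On the pair `(n, a)`, the search looks for a `b` refuting the witness `a`; it halts for every
  -- `a` exactly when `n ∉ B`. Currying in `n` gives the code `g n`.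
  let φ : ℕ →. ℕ := fun m => Nat.rfind fun b => Part.some (!f (m.unpair.1, m.unpair.2, b))
  have hφ : Partrec φ := by
    refine Partrec.rfind (p := fun (m b : ℕ) => Part.some (!f (m.unpair.1, m.unpair.2, b)))
      (Computable.partrec ?_)
    have h1 : Primrec fun q : ℕ × ℕ => q.1.unpair := Primrec.unpair.comp .fst
    exact Primrec.not.to_comp.comp (hf.comp
      ((Primrec.fst.comp h1).pair ((Primrec.snd.comp h1).pair .snd)).to_comp)
  obtain ⟨c, hc⟩ := Code.exists_code.1 (Partrec.nat_iff.1 hφ)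
  refine ⟨fun n => Encodable.encode (c.curry n),
    Primrec.encode.comp (Code.primrec₂_curry.comp (Primrec.const c) .id), fun n => ?_⟩
  rw [hB, ← not_iff_not, not_not, not_exists]
  refine forall_congr' fun a => ?_
  rw [Denumerable.ofNat_encode, Code.eval_curry, hc]
  refine Iff.trans ?_ Nat.rfind_dom.symm
  simp only [Nat.unpair_pair, not_forall, Bool.not_eq_true]
  refine exists_congr fun b => ⟨fun h => ⟨Part.mem_some_iff.2 (by simp [h]), fun _ => trivial⟩,
    fun h => by simpa using Part.mem_some_iff.1 h.1⟩

end Stages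

theorem EnumReducible.of_primrec {A B : Set ℕ} {g : ℕ → ℕ} (hg : Primrec g)
    (h : ∀ n, n ∈ A ↔ g n ∈ B) : EnumReducible A B := by
  refine ⟨{p | p.2 = [g p.1]}, ?_, fun n => by simp [h]⟩
  exact (Primrec.eq.comp Primrec.snd (Primrec.list_cons.comp (hg.comp .fst)
    (Primrec.const []))).computablePred.to_re

-- A stream with a `Π₂`-complete limit set

namespace Config

/-- The stream whose `n`-th dyadic block is `0 ^ n 1 0 ^ (stageCode n) S 0 ⋯ 0`, with second layer
constantly `0`. -/
noncomputable def stageStream (p : ℕ) : Letter :=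
  if p = 2 ^ Nat.log 2 p + Nat.log 2 p then (1, 0)
  else if p = 2 ^ Nat.log 2 p + Nat.log 2 p + stageCode (Nat.log 2 p) + 1 then (2, 0)
  else 0

theorem primrec_stageStream : Primrec stageStream := by
  have hs : Primrec fun p : ℕ => 2 ^ Nat.log 2 p + Nat.log 2 p :=
    Primrec.nat_add.comp (primrec_two_pow.comp Primrec.nat_log_two) Primrec.nat_log_two
  exact Primrec.ite (Primrec.eq.comp .id hs) (Primrec.const _)
    (Primrec.ite (Primrec.eq.comp .id (Primrec.succ.comp
      (Primrec.nat_add.comp hs (primrec_stageCode.comp Primrec.nat_log_two))))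
      (Primrec.const _) (Primrec.const _))

theorem stageStream_snd (p : ℕ) : (stageStream p).2 = 0 := by
  rw [stageStream]
  split_ifs <;> rfl

/-- Provides the room in block `n`: the last nonzero letter has offset at most `2 * n + 2`, well
before `2 ^ n`. -/
theorem five_mul_le_two_pow {n : ℕ} (hn : 5 ≤ n) : 5 * n ≤ 2 ^ n := by
  induction n, hn using Nat.le_induction with
  | base => norm_num
  | succ n hn ih =>
    rw [pow_succ]
    omega

theorem log_two_eq {n p : ℕ} (h1 : 2 ^ n ≤ p) (h2 : p < 2 ^ (n + 1)) : Nat.log 2 p = n :=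
  (Nat.log_eq_iff (Or.inr ⟨one_lt_two, by have := Nat.two_pow_pos n; omega⟩)).2 ⟨h1, h2⟩

theorem stageStream_two_pow_add {n i : ℕ} (hi : i < 2 ^ n) : stageStream (2 ^ n + i) =
    if i = n then (1, 0) else if i = n + stageCode n + 1 then (2, 0) else 0 := by
  rw [stageStream, log_two_eq (Nat.le_add_right _ _) (by rw [pow_succ]; omega)]
  have h1 : 2 ^ n + i = 2 ^ n + n ↔ i = n := by omega
  have h2 : 2 ^ n + i = 2 ^ n + n + stageCode n + 1 ↔ i = n + stageCode n + 1 := by omega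
  simp only [h1, h2]

/-- Nonzero letters of the stream are far away from the ends of their blocks. -/
theorem exists_of_stageStream_ne_zero {p l : ℕ} (hp : 2 ^ (l + 5) ≤ p) (h : stageStream p ≠ 0) :
    ∃ n, l + 5 ≤ n ∧ 2 ^ n + l ≤ p ∧ p + l < 2 ^ (n + 1) := by
  have hn : l + 5 ≤ Nat.log 2 p := Nat.le_log_of_pow_le one_lt_two hp
  have h5 := five_mul_le_two_pow (n := Nat.log 2 p) (by omega)
  have hs := stageCode_le (Nat.log 2 p)
  refine ⟨Nat.log 2 p, hn, ?_⟩
  rw [pow_succ]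
  rw [stageStream] at h
  split_ifs at h with h1 h2
  · omega
  · omega
  · exact absurd rfl h

theorem frequently_of_forall_ge {P : ℕ → Prop} {a : ℕ} (h : ∀ n ≥ a, P (2 ^ n)) :
    ∃ᶠ p in atTop, P p :=
  frequently_atTop.2 fun b => ⟨2 ^ max a b,
    (le_max_right a b).trans Nat.lt_two_pow_self.le, h _ (le_max_left a b)⟩

theorem stageStream_zero_window {l n i : ℕ} (hn : l ≤ n) (hi : i < l) :
    stageStream (2 ^ n + i) = 0 := by
  rw [stageStream_two_pow_add ((hi.trans_le hn).trans Nat.lt_two_pow_self), if_neg (by omega),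
    if_neg (by omega)]

/-- The word `1 0 ^ (e + 1) S`. -/
def markedWord (e : ℕ) : List Letter :=
  (List.range (e + 3)).map fun i => if i = 0 then (1, 0) else if i = e + 2 then (2, 0) else 0

theorem primrec_markedWord : Primrec markedWord := by
  refine Primrec.list_map (Primrec.list_range.comp (Primrec.nat_add.comp .id (Primrec.const 3))) ?_
  exact Primrec.ite (Primrec.eq.comp .snd (Primrec.const 0)) (Primrec.const _)
    (Primrec.ite (Primrec.eq.comp .snd (Primrec.nat_add.comp .fst (Primrec.const 2)))
      (Primrec.const _) (Primrec.const _))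

/-- A late occurrence of the word lies in a single block, since its nonzero letters are far from the
ends. The only `1` and the only `S` of block `n` are at distance `stageCode n + 1`, so the
occurrence forces `stageCode n = e + 1`. -/
theorem frequently_markedWord_iff (e : ℕ) :
    (∃ᶠ p in atTop, drop stageStream p ∈
      closedIdealBall (Config Letter) (ballIndex (markedWord e) (markedWord e).length)) ↔
    ∃ᶠ n in atTop, stageCode n = e + 1 := by
  have hmem : ∀ p, drop stageStream p ∈
      closedIdealBall (Config Letter) (ballIndex (markedWord e) (markedWord e).length) ↔
      ∀ i < e + 3, stageStream (p + i) =
        if i = 0 then (1, 0) else if i = e + 2 then (2, 0) else 0 := fun p => by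
    rw [mem_closedIdealBall_ballIndex]
    simp only [markedWord, List.length_map, List.length_range]
    refine forall₂_congr fun i hi => ?_
    simp [drop, hi]
  simp only [hmem]
  constructor
  · intro h
    refine frequently_atTop.2 fun a => ?_
    -- The exponent yields a margin `a + e + 3`, covering the word of length `e + 3` and making the
    -- block index exceed `a`.
    obtain ⟨p, hp, h⟩ := frequently_atTop.1 h (2 ^ (a + e + 3 + 5))
    have h0 := h 0 (by omega)
    have h1 := h (e + 2) (by omega)
    rw [if_neg (by omega), if_pos rfl] at h1
    rw [if_pos rfl, add_zero] at h0
    obtain ⟨n, hn, hnp, hpn⟩ := exists_of_stageStream_ne_zero hp (by rw [h0]; decide)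
    obtain ⟨i, rfl⟩ := Nat.exists_eq_add_of_le (le_trans (Nat.le_add_right _ _) hnp)
    rw [pow_succ] at hpn
    rw [stageStream_two_pow_add (by omega)] at h0
    rw [add_assoc, stageStream_two_pow_add (by omega)] at h1
    refine ⟨n, by omega, ?_⟩
    have hi : i = n := by
      by_contra hc
      rw [if_neg hc] at h0
      split_ifs at h0 <;> revert h0 <;> decide
    have hi' : i + (e + 2) = n + stageCode n + 1 := by
      by_contra hc
      rw [if_neg hc] at h1
      split_ifs at h1 <;> revert h1 <;> decide
    omega
  · intro h
    refine frequently_atTop.2 fun a => ?_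
    obtain ⟨n, hn, h⟩ := frequently_atTop.1 h (a + 5)
    have h5 := five_mul_le_two_pow (n := n) (by omega)
    have hs := stageCode_le n
    refine ⟨2 ^ n + n, by have := Nat.lt_two_pow_self (n := n); omega, fun i hi => ?_⟩
    rw [add_assoc, stageStream_two_pow_add (by omega), h]
    have h1 : n + i = n ↔ i = 0 := by omega
    have h2 : n + i = n + (e + 1) + 1 ↔ i = e + 2 := by omega
    simp only [h1, h2]

theorem isPiTwoComplete_streamLimits_stageStream :
    IsPiTwoComplete (streamLimits stageStream) := by
  refine ⟨isPiTwo_streamLimits primrec_stageStream, fun K' hK' => ?_⟩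
  obtain ⟨g, hg, h⟩ := hK'.2.exists_primrec_code
  refine EnumReducible.of_primrec (g := fun n =>
    ballIndex (markedWord (g n)) (markedWord (g n)).length) ?_ fun n => ?_
  · have := primrec_markedWord.comp hg
    exact primrec_ballIndex this (Primrec.list_length.comp this)
  · rw [h, mem_outerBalls_streamLimits, frequently_markedWord_iff, frequently_stageCode_eq_iff]

end Config

-- The universal stream and the limit sets of the two mixtures

namespace Config

/-- The stream whose `n`-th dyadic block starts with the first layer of the word with code
`n.unpair.1`. The second layer is constantly `0`. -/
def wordStream (p : ℕ) : Letter :=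
  (((word Letter (Nat.log 2 p).unpair.1).getD (p - 2 ^ Nat.log 2 p) default).1, 0)

theorem primrec_wordStream : Primrec wordStream := by
  refine Primrec.pair (Primrec.fst.comp ((Primrec.list_getD default).comp
    (primrec_word.comp ?_) ?_)) (Primrec.const 0)
  · exact Primrec.fst.comp (Primrec.unpair.comp Primrec.nat_log_two)
  · exact Primrec.nat_sub.comp .id (primrec_two_pow.comp Primrec.nat_log_two)

theorem frequently_mem_blocksWith_wordStream {z : ℕ → Letter} (hz : ∀ i, (z i).2 = 0) (l : ℕ) :
    ∃ᶠ n in atTop, n ∈ blocksWith wordStream ((List.range l).map z) := by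
  refine frequently_atTop.2 fun a =>
    -- The second component is free: it makes the block index at least `a`, and at least `l` so that
    -- the word fits in the block.
    ⟨Nat.pair (Encodable.encode ((List.range l).map z)) (max a l),
      (le_max_left a l).trans (Nat.right_le_pair _ _), ?_⟩
  have hl := (le_max_right a l).trans (Nat.right_le_pair
    (Encodable.encode ((List.range l).map z)) (max a l))
  generalize hn : Nat.pair (Encodable.encode ((List.range l).map z)) (max a l) = n at hl ⊢
  have h2 := Nat.lt_two_pow_self (n := n)
  refine mem_blocksWith_map_range.2 ⟨2 ^ n, le_rfl, by rw [pow_succ]; omega, fun i hi => ?_⟩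
  rw [wordStream, log_two_eq (Nat.le_add_right _ _) (by rw [pow_succ]; omega), ← hn]
  simp [word, hi, ← hz i]

/-- Recurrence in the stream must be upgraded to recurrence inside single blocks. Zero windows occur
at the start of every large block, and a late window with a nonzero letter cannot cross a block
boundary. -/
theorem frequently_mem_blocksWith_stageStream {z : Config Letter}
    (hz : z ∈ streamLimits stageStream) (l : ℕ) :
    ∃ᶠ n in atTop, n ∈ blocksWith stageStream ((List.range l).map z) := by
  refine frequently_atTop.2 fun a => ?_
  by_cases h0 : ∀ i < l, z i = 0
  · refine ⟨max a l, le_max_left a l, mem_blocksWith_map_range.2 ⟨2 ^ max a l, le_rfl, ?_,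
      fun i hi => (stageStream_zero_window (le_max_right a l) hi).trans (h0 i hi).symm⟩⟩
    have := Nat.lt_two_pow_self (n := max a l)
    rw [pow_succ]
    omega
  · push Not at h0
    obtain ⟨j, hj, hzj⟩ := h0
    obtain ⟨p, hp, h⟩ := frequently_atTop.1 (hz l) (2 ^ (a + l + 5))
    obtain ⟨n, hn, hnp, hpn⟩ := exists_of_stageStream_ne_zero (p := p + j)
      (hp.trans (Nat.le_add_right _ _)) (by rwa [h j hj])
    exact ⟨n, by omega, mem_blocksWith_map_range.2 ⟨p, by omega, by omega, h⟩⟩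

/-- A zero window is a recurrent window of `stageStream` anyway. A nonzero letter of the mixture can
only come from a rare block, and the whole window around it then lies in that block, where the
mixture copies `stageStream`. -/
theorem streamLimits_mixture_zero_subset (x : Config Letter) :
    streamLimits (mixture (fun _ => 0) stageStream x) ⊆ streamLimits stageStream := by
  intro z hz l
  by_cases h0 : ∀ i < l, z i = 0
  · exact frequently_of_forall_ge (a := l) fun n hn i hi =>
      (stageStream_zero_window hn hi).trans (h0 i hi).symm
  · push Not at h0
    obtain ⟨j, hj, hzj⟩ := h0
    refine ((hz l).and_eventually (eventually_ge_atTop (2 ^ (l + 5)))).mono fun p hp => ?_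
    obtain ⟨h, hp⟩ := hp
    have hj' := h j hj
    by_cases hr : IsRare (Nat.log 2 (p + j)) x
    · rw [mixture, if_pos hr] at hj'
      obtain ⟨n, hn, hnp, hpn⟩ := exists_of_stageStream_ne_zero (p := p + j)
        (hp.trans (Nat.le_add_right _ _)) (by rwa [hj'])
      rw [log_two_eq (n := n) (by omega) (by omega)] at hr
      intro i hi
      rw [← h i hi, mixture, log_two_eq (n := n) (by omega) (by omega), if_pos hr]
    · rw [mixture, if_neg hr] at hj'
      exact absurd hj'.symm hzj

theorem streamLimits_zero :
    streamLimits (fun _ => 0) = {x : Config Letter | ∀ i, x i ∈ ({0} : Set Letter)} := by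
  ext z
  constructor
  · intro hz i
    obtain ⟨n, hn⟩ := (hz (i + 1)).exists
    exact (hn i (Nat.lt_succ_self i)).symm
  · exact fun hz l => Frequently.of_forall fun n i _ => (hz i).symm

theorem exists_mem_streamLimits_stageStream : ∃ z ∈ streamLimits stageStream, z 0 = (1, 0) := by
  have h := (inter_streamLimits_nonempty_iff (s := {z : Config Letter | z 0 = (1, 0)})
    (isClopen_of_forall_lt 1 fun x y hxy hx => (hxy 0 one_pos).trans hx) stageStream).2
    (frequently_atTop.2 fun a => ⟨2 ^ a + a, Nat.le_add_left _ _, ?_⟩)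
  · obtain ⟨z, hz, hz'⟩ := h
    exact ⟨z, hz', hz⟩
  · exact (stageStream_two_pow_add Nat.lt_two_pow_self).trans (if_pos rfl)

/-- Each block has a single letter `(1, 0)`, so two adjacent ones do not recur. This separates the
limit set from the full shift over the second layer `0`. -/
theorem const_notMem_streamLimits_stageStream :
    (fun _ => (1, 0) : Config Letter) ∉ streamLimits stageStream := by
  intro hz
  obtain ⟨p, hp, h⟩ := frequently_atTop.1 (hz 2) (2 ^ 7)
  have h0 := h 0 (by norm_num)
  have h1 := h 1 (by norm_num)
  rw [add_zero] at h0
  obtain ⟨n, hn, hnp, hpn⟩ := exists_of_stageStream_ne_zero (l := 2) hp (by rw [h0]; decide)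
  obtain ⟨i, rfl⟩ := Nat.exists_eq_add_of_le (le_trans (Nat.le_add_right _ _) hnp)
  rw [pow_succ] at hpn
  have key : ∀ j < 2 ^ n, stageStream (2 ^ n + j) = (1, 0) → j = n := fun j hj hs => by
    rw [stageStream_two_pow_add hj] at hs
    by_contra hc
    rw [if_neg hc] at hs
    split_ifs at hs <;> revert hs <;> decide
  have e0 := key i (by omega) h0
  have e1 := key (i + 1) (by omega) h1
  omega

end Config

-- The two maps

open Config in
theorem mainTheorem4 :
    (∃ T' : Config Letter → Config Letter, IsComputableMap T' ∧
      ∃ M A : Set (Config Letter),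
        IsMetricAttractor (Config.uniformBernoulli Letter) T' M ∧ IsComputableClosed M ∧
        IsTopologicalAttractor T' A ∧ IsPiTwoComplete A ∧ M ≠ A) ∧
    (∃ T'' : Config Letter → Config Letter, IsComputableMap T'' ∧
      ∃ M A : Set (Config Letter),
        IsMetricAttractor (Config.uniformBernoulli Letter) T'' M ∧ IsPiTwoComplete M ∧
        IsTopologicalAttractor T'' A ∧ IsComputableClosed A ∧ M ≠ A) := by
  constructor
  · have hD : ∀ n : ℕ, ((fun _ => 0 : ℕ → Letter) n).2 = 0 := fun _ => rfl
    refine ⟨mixMap (fun _ => 0) stageStream,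
      isComputableMap_mixMap (Primrec.const 0) primrec_stageStream,
      streamLimits fun _ => 0, streamLimits stageStream,
      isMetricAttractor_of_ae_omegaSet_eq (isClosed_streamLimits _)
        (ae_omegaSet_mixMap hD stageStream_snd), ?_,
      isTopologicalAttractor_of_residual_omegaSet_eq (isClosed_streamLimits _) ?_,
      isPiTwoComplete_streamLimits_stageStream, fun h => ?_⟩
    · rw [streamLimits_zero]
      exact isComputableClosed_forall_mem (Primrec.eq.comp .id (Primrec.const 0)) rfl
    · filter_upwards [residual_omegaSet_mixMap hD stageStream_snd] with x hx
      rw [hx.1]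
      exact (streamLimits_mixture_zero_subset x).antisymm
        (Set.Subset.trans (fun z hz => frequently_mem_blocksWith_stageStream hz) hx.2)
    · obtain ⟨z, hz, hz0⟩ := exists_mem_streamLimits_stageStream
      rw [← h, streamLimits_zero] at hz
      have h1 : z 0 = 0 := hz 0
      rw [h1] at hz0
      revert hz0
      decide
  · have hR : ∀ n, (wordStream n).2 = 0 := fun _ => rfl
    have hA : IsComputableClosed {x : Config Letter | ∀ i, x i ∈ {c : Letter | c.2 = 0}} :=
      isComputableClosed_forall_mem (Primrec.eq.comp Primrec.snd (Primrec.const 0)) rfl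
    refine ⟨mixMap stageStream wordStream,
      isComputableMap_mixMap primrec_stageStream primrec_wordStream,
      streamLimits stageStream, _,
      isMetricAttractor_of_ae_omegaSet_eq (isClosed_streamLimits _)
        (ae_omegaSet_mixMap stageStream_snd hR), isPiTwoComplete_streamLimits_stageStream,
      isTopologicalAttractor_of_residual_omegaSet_eq hA.1 ?_, hA, fun h => ?_⟩
    · filter_upwards [residual_omegaSet_mixMap stageStream_snd hR] with x hx
      rw [hx.1]
      -- Both streams have second layer `0`, hence so do the mixture and its limits; the converse
      -- inclusion is the universality of `wordStream`.
      refine Set.Subset.antisymm (fun z hz i => ?_)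
        (Set.Subset.trans (fun z hz => frequently_mem_blocksWith_wordStream hz) hx.2)
      obtain ⟨n, hn⟩ := (hz (i + 1)).exists
      rw [← hn i (Nat.lt_succ_self i)]
      exact mixture_snd stageStream_snd hR _
    · refine const_notMem_streamLimits_stageStream ?_
      rw [h]
      exact fun i => rfl
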